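/- **Conventions.** A *loop* is a set $G$ with a multiplication having a neutral element $e$ and such that for all $a,b\in G$ the equations $ax=b$ and $ya=b$ have unique solutions $x=a\backslash b$ and $y=b/a$. The center $Z(G)$ is the set of elements that commute with all elements of $G$ and associate with all pairs of elements (in every position). A *metagroup* is a loop with $(ab)c=t(a,b,c)\,a(bc)$, $t(a,b,c)\in Z(G)$, for all $a,b,c$; it is *central* if also $ab=t_2(a,b)\,ba$ with $t_2(a,b)\in Z(G)$ for all $a,b$. $Z_m(G)$ is the smallest subgroup of $Z(G)$ containing all $t(a,b,c)$. Put $[a,b]=(e/a)((e/b)(ab))$. A submetagroup (subloop) is a subset containing $e$ and closed under multiplication and both divisions; "generated" refers to this notion, and $[H,K]$ is the subloop generated by all $[h,k]$, $h\in H$, $k\in K$. **Smashed splitting extensions.** Let $D$, $B$ be metagroups, $A\subseteq D$ a submetagroup, and $Z$ a commutative group with (compatible) embeddings $Z_m(A)\subseteq Z\subseteq Z(A)$ and $Z_m(B)\subseteq Z\subseteq Z(B)$. Let $\Xi$ be the equivalence relation on $A\times B$ generated by $(\gamma a,b)\,\Xi\,(a,\gamma b)$, $\gamma\in Z$. Smashing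 factors are maps $\phi$ from $A$ to the bijections of $B$ (write $b^a=\phi(a)b$), $\eta:A\times A\times B\to Z$, $\kappa:A\times B\times B\to Z$ and $\xi:((A\times B)/\Xi)^2\to Z$ such that, for all $u,v\in A$, $b,c\in B$, $\gamma\in Z$, $$(b^u)^v=b^{vu}\eta(v,u,b),\quad e^u=e,\quad b^e=b,\quad \eta(v,u,\gamma b)=\eta(v,u,b),\quad (cb)^u=c^ub^u\kappa(u,c,b),$$ $$\kappa(u,\gamma c,b)=\kappa(u,c,\gamma b)=\kappa(u,c,b),\quad \kappa(u,\gamma,b)=\kappa(u,b,\gamma)=e,$$ $$\xi((\gamma u,c),(v,b))=\xi((u,c),(\gamma v,b))=\xi((u,c),(v,b)),\quad \xi((\gamma,e),(v,b))=\xi((u,c),(\gamma,e))=e,$$ $$\gamma^u=\gamma,\quad b^\gamma=b.$$ Let $V\subseteq D$ be a right transversal of $A$ with $e\in V$: each $a\in D$ is uniquely $a=a^\psi a^\tau$ with $a^\psi\in A$, $a^\tau\in V$. Put $v^{[c]}=(vc)^\tau$ and $s(d,v)=e/(v/d)^\psi$ for $v\in V$, $c,d\in D$. Let $F^*$ be the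 metagroup of maps $f:V\to B$ with $f(v)\ne e$ for only finitely many $v$, under pointwise multiplication, and put $f^{\{d\}}(v)=\big(f(v^{[d\backslash e]})\big)^{s(d,v)}$. If $$(d_1,f_1)(d,f)=\big(d_1d,\ \xi((d_1^\psi,f_1),(d^\psi,f))\,f_1f^{\{d_1\}}\big)$$ (with $\xi((d_1^\psi,f_1),(d^\psi,f))(v)=\xi((d_1^\psi,f_1(v)),(d^\psi,f(v)))$) is an operation on $D\times F^*$, then $D\times F^*$ with this operation is called a smashed splitting extension $C^*$ of $F^*$ by $D$; $D$ and $F^*$ are embedded in $C^*$ by $d\mapsto(d,e)$ and $f\mapsto(e,f)$. **Corollary 4.15.** Let $D$ be a metagroup generated by $Z_m(D)$ and a family of elements $(d_j)_{j\in J}$, where $J$ has two distinct members $1$ and $2$ with $d_1\ne e$ and $[d_2\backslash e,\,d_1\backslash e]=e$. Then there exists a smashed splitting extension $C^*$ of some $F^*$ by $D$, as above, such that 1. $C^*$ is a metagroup and $F^*$ is a central metagroup with $F^*\neq\{e\}$; moreover $F^*\ne Z(F^*)$ whenever $D\neq Z(D)$; 2. $[F^*,C^*]\,Z(F^*)=F^*$;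 3. there are elements $c_j\in C^*$ $(j\in J)$ with $d_j\backslash e\in F^*c_j$ for each $j\in J$, such that $C^*$ is generated by $Z(F^*)$ and $\{c_j:j\in J\}$. -/

import Mathlib

open scoped Pointwise

universe u v

/-- `b / a`, the solution `y` of `y * a = b`
(unique whenever the multiplication is that of a quasi-group). -/
noncomputable def rdiv {G : Type*} [Mul G] [One G] (b a : G) : G :=
  @Classical.epsilon G ⟨1⟩ (fun y => y * a = b)

/-- `a \ b`, the solution `x` of `a * x = b`
(unique whenever the multiplication is that of a quasi-group). -/
noncomputable def ldiv {G : Type*} [Mul G] [One G] (a b : G) : G :=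
  @Classical.epsilon G ⟨1⟩ (fun x => a * x = b)

/-- Loops: unique left and right division, and a neutral element. -/
structure IsLoop (G : Type*) [Mul G] [One G] : Prop where
  existsUnique_ldiv : ∀ a b : G, ∃! x, a * x = b
  existsUnique_rdiv : ∀ a b : G, ∃! y, y * a = b
  one_mul : ∀ a : G, 1 * a = a
  mul_one : ∀ a : G, a * 1 = a

/-- Metagroups: loops in which `(ab)c = t(a,b,c) a(bc)` with `t(a,b,c)` in the center.
`Set.center G` consists of the elements which commute and associate with all of `G`. -/
structure IsMetagroup (G : Type*) [Mul G] [One G] : Prop extends IsLoop G where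
  assoc : ∀ a b c : G, ∃ t ∈ Set.center G, (a * b) * c = t * (a * (b * c))

/-- Central metagroups: metagroups with `ab = t₂(a,b) ba`, where `t₂(a,b)` is in the center. -/
structure IsCentralMetagroup (G : Type*) [Mul G] [One G] : Prop extends IsMetagroup G where
  comm : ∀ a b : G, ∃ t ∈ Set.center G, a * b = t * (b * a)

/-- Subloops (in a metagroup: submetagroups): subsets which contain `e` and
are closed under multiplication and under both divisions. -/
structure IsSubloop {G : Type*} [Mul G] [One G] (S : Set G) : Prop where
  one_mem : (1 : G) ∈ S
  mul_mem : ∀ a ∈ S, ∀ b ∈ S, a * b ∈ S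
  ldiv_mem : ∀ a ∈ S, ∀ b ∈ S, ∀ x, a * x = b → x ∈ S
  rdiv_mem : ∀ a ∈ S, ∀ b ∈ S, ∀ y, y * a = b → y ∈ S

/-- The subloop generated by a subset. -/
def generated {G : Type*} [Mul G] [One G] (X : Set G) : Set G :=
  {x | ∀ S : Set G, IsSubloop S → X ⊆ S → x ∈ S}

/-- The associator `t(a,b,c) = ((ab)c)/(a(bc))`. -/
noncomputable def assocFactor {G : Type*} [Mul G] [One G] (a b c : G) : G :=
  rdiv ((a * b) * c) (a * (b * c))

/-- `Z_m(G)`, generated by all associators `t(a,b,c)`. In a metagroup these lie in the commutative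
group `Z(G)`, so that the generated subloop is the smallest subgroup of `Z(G)` containing them. -/
def Zm (G : Type*) [Mul G] [One G] : Set G :=
  generated {t | ∃ a b c : G, t = assocFactor a b c}

/-- `[a,b] = (e/a)((e/b)(ab))`. -/
noncomputable def loopComm {G : Type*} [Mul G] [One G] (a b : G) : G :=
  rdiv 1 a * (rdiv 1 b * (a * b))

/-- `[H,K]`, the subloop generated by the commutators `[h,k]`, `h ∈ H`, `k ∈ K`. -/
def commSubloop {G : Type*} [Mul G] [One G] (H K : Set G) : Set G :=
  generated {x | ∃ h ∈ H, ∃ k ∈ K, x = loopComm h k}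

/-- The relation on `A × B` identifying `(γ v, b)` with `(v, γ b)` for `γ` in `Z`
(either of them being `γ (v, b) = (v, b) γ`).
The quotient `Quot` is by the equivalence relation that it generates. -/
inductive XiRel {A B Z : Type*} [Mul A] [Mul B] (jA : Z → A) (jB : Z → B) :
    A × B → A × B → Prop
  | intro (γ : Z) (v : A) (b : B) : XiRel jA jB (jA γ * v, b) (v, jB γ * b)

/-- Smashing factors `φ, η, κ, ξ` for `A` and `B` over a commutative group `Z` with
`Z_m(A) ⊆ Z ⊆ Z(A)` and `Z_m(B) ⊆ Z ⊆ Z(B)`; here `b ^ a` is `φ a b`. -/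
structure SmashingFactors (A B Z : Type*) [MulOneClass A] [MulOneClass B] [CommGroup Z] where
  /-- the embedding of `Z` into the center of `A` -/
  jA : Z →* A
  /-- the embedding of `Z` into the center of `B` -/
  jB : Z →* B
  jA_injective : Function.Injective jA
  jB_injective : Function.Injective jB
  jA_center : ∀ γ, jA γ ∈ Set.center A
  jB_center : ∀ γ, jB γ ∈ Set.center B
  Zm_A : Zm A ⊆ Set.range jA
  Zm_B : Zm B ⊆ Set.range jB
  φ : A → Equiv.Perm B
  η : A → A → B → Z
  κ : A → B → B → Z
  ξ : Quot (XiRel jA jB) → Quot (XiRel jA jB) → Z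
  /-- `(b^u)^v = b^{vu} η(v,u,b)` -/
  φ_φ : ∀ v u b, φ v (φ u b) = φ (v * u) b * jB (η v u b)
  φ_one : ∀ u, φ u 1 = 1
  one_φ : ∀ b, φ 1 b = b
  /-- `η(v,u,γb) = η(v,u,b)` -/
  η_Z : ∀ v u γ b, η v u (jB γ * b) = η v u b
  /-- `(cb)^u = c^u b^u κ(u,c,b)` -/
  φ_mul : ∀ u c b, φ u (c * b) = (φ u c * φ u b) * jB (κ u c b)
  κ_Z_left : ∀ u γ c b, κ u (jB γ * c) b = κ u c b
  κ_Z_right : ∀ u γ c b, κ u c (jB γ * b) = κ u c b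
  κ_Z_one : ∀ u γ b, κ u (jB γ) b = 1
  κ_one_Z : ∀ u γ b, κ u b (jB γ) = 1
  ξ_Z_left : ∀ γ u c v b,
    ξ (Quot.mk _ (jA γ * u, c)) (Quot.mk _ (v, b)) = ξ (Quot.mk _ (u, c)) (Quot.mk _ (v, b))
  ξ_Z_right : ∀ γ u c v b,
    ξ (Quot.mk _ (u, c)) (Quot.mk _ (jA γ * v, b)) = ξ (Quot.mk _ (u, c)) (Quot.mk _ (v, b))
  ξ_Z_one : ∀ γ v b, ξ (Quot.mk _ (jA γ, 1)) (Quot.mk _ (v, b)) = 1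
  ξ_one_Z : ∀ γ u c, ξ (Quot.mk _ (u, c)) (Quot.mk _ (jA γ, 1)) = 1
  /-- `γ^a = γ` -/
  φ_Z : ∀ a γ, φ a (jB γ) = jB γ
  /-- `b^γ = b` -/
  Z_φ : ∀ γ b, φ (jA γ) b = b

/-- Right transversals of `A` in `D` containing `e`:
every `a ∈ D` is uniquely `a = s b` with `s ∈ A` and `b ∈ V`. -/
structure RightTransversal {D : Type*} [MulOneClass D] (A : Submonoid D) where
  carrier : Set D
  one_mem : (1 : D) ∈ carrier
  existsUnique : ∀ a : D, ∃! p : A × carrier, a = (p.1 : D) * (p.2 : D)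

namespace RightTransversal

variable {D : Type*} [MulOneClass D] {A : Submonoid D} (V : RightTransversal A)

/-- The `A`-component in `a = a^ψ a^τ`. -/
noncomputable def ψ (a : D) : A := (V.existsUnique a).choose.1

/-- The `V`-component in `a = a^ψ a^τ`. -/
noncomputable def τ (a : D) : V.carrier := (V.existsUnique a).choose.2

/-- `v^[c] = (v c)^τ`. -/
noncomputable def bracket (v : V.carrier) (c : D) : V.carrier := V.τ ((v : D) * c)

/-- `s(d,v) = e/(v/d)^ψ`. -/
noncomputable def s (d : D) (v : V.carrier) : A := rdiv 1 (V.ψ (rdiv (v : D) d))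

/-- `F* = B^(V)`: the maps `V → B` of finite support, with the pointwise multiplication. -/
def FStar (B : Type*) [MulOneClass B] : Submonoid (V.carrier → B) where
  carrier := {f | (Function.mulSupport f).Finite}
  one_mem' := by simp [Function.mulSupport_one]
  mul_mem' := fun {f g} hf hg =>
    (hf.union hg).subset (Function.mulSupport_mul f g)

end RightTransversal

namespace SmashingFactors

variable {D : Type*} [MulOneClass D] {A : Submonoid D} {B Z : Type*} [MulOneClass B] [CommGroup Z]
  (S : SmashingFactors A B Z) (V : RightTransversal A)

/-- `f^{d}(v) = f(v^[d\e])^{s(d,v)}`. -/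
noncomputable def act (d : D) (f : V.carrier → B) : V.carrier → B :=
  fun v => S.φ (V.s d v) (f (V.bracket v (ldiv d 1)))

/-- The second component `ξ((d₁^ψ,f₁),(d^ψ,f)) f₁ f^{d₁}` of the product `(d₁,f₁)(d,f)`. -/
noncomputable def mulSnd (d₁ : D) (f₁ : V.carrier → B) (d : D) (f : V.carrier → B) :
    V.carrier → B :=
  fun v => S.jB (S.ξ (Quot.mk _ (V.ψ d₁, f₁ v)) (Quot.mk _ (V.ψ d, f v))) *
    (f₁ v * S.act V d₁ f v)

/-- The product formula is an operation on `D × F*`. -/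
def Closed : Prop :=
  ∀ d₁, ∀ f₁ ∈ V.FStar B, ∀ d, ∀ f ∈ V.FStar B, S.mulSnd V d₁ f₁ d f ∈ V.FStar B

/-- The smashed splitting extension (restricted smashed twisted wreath product)
`C* = D Δ^{φ,η,κ,ξ} F*`. -/
@[ext]
structure CStar (h : S.Closed V) where
  fst : D
  snd : V.FStar B

namespace CStar

variable {S V} {h : S.Closed V}

noncomputable instance : Mul (CStar S V h) where
  mul x y := ⟨x.fst * y.fst,
    S.mulSnd V x.fst x.snd y.fst y.snd, h _ _ x.snd.2 _ _ y.snd.2⟩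

instance : One (CStar S V h) where
  one := ⟨1, 1⟩

variable (h)

/-- The embedding `d ↦ (d, e)` of `D` into `C*`. -/
def ofD (d : D) : CStar S V h := ⟨d, 1⟩

/-- The embedding `f ↦ (e, f)` of `F*` into `C*`. -/
def ofF (f : V.FStar B) : CStar S V h := ⟨1, f⟩

end CStar

end SmashingFactors

/-! Take `A = D` and `V = {e}`, so that `F*` is a copy of `B`, and `η = κ = ξ = e`. An action `ρ` of
the group `Q = D/Z(D)` on a group `B` then makes `C*` a semidirect product with associators
`(t(a,b,c), e)` (`pair_mul_pair`, `assocFactor_pair`). The role of `Z` is played by `Z(D)`, a copy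
of which is added to `B` as a direct factor with trivial action.

Suppose that `B` has class at most two, that `g` is the image of `d₁` in `Q`, and that `m ∈ B` is
such that every `Q`-invariant subgroup containing `Z(B)` and `m⁻¹ g(m)` is `B`. Put `c₂ = (d₂\e, m)`
and `c_j = (d_j\e, e)` otherwise. Since `[d₂\e, d₁\e] = e`, the commutator `[c₂, c₁]` lies in `F*`,
and it is `m⁻¹ g(m)` up to the action of `Q`. Hence the subloop generated by the `c_j` and `Z(F*)`
contains `F*` (`exists_generators`). The same property of `m` gives `[F*,C*] Z(F*) = F*`
(`commSubloop_mul_center`).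

If `g ≠ e` and `Q` has order greater than two, such a nonabelian `B` exists
(`exists_action_of_ne_one`): `m` comes from a coboundary `u - g u` with values in `ℤ/(n+1)`, where
`g ^ n` fixes `u`. Modulo `K` all `g ^ j (m)` agree, and their product over `j < n` telescopes to a
central element; so `m ^ n ∈ K`, while `m ^ (n+1)` is central. Order two is impossible for `Q`
(`exists_ne_of_center_ne`). If `d₁` is central, a noncentral generator takes its place, with `d₁` in
the place of `d₂`; if `D = Z(D)`, an abelian `B` suffices. -/

/-! ### Division, the center and subloops of a loop. -/

namespace IsLoop

variable {G : Type*} [Mul G] [One G]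

theorem mul_left_cancel (h : IsLoop G) {a x y : G} (hxy : a * x = a * y) : x = y :=
  (h.existsUnique_ldiv a (a * y)).unique hxy rfl

theorem mul_right_cancel (h : IsLoop G) {a x y : G} (hxy : x * a = y * a) : x = y :=
  (h.existsUnique_rdiv a (y * a)).unique hxy rfl

theorem mul_ldiv (h : IsLoop G) (a b : G) : a * ldiv a b = b :=
  @Classical.epsilon_spec_aux G ⟨1⟩ (fun x => a * x = b) (h.existsUnique_ldiv a b).exists

theorem rdiv_mul (h : IsLoop G) (b a : G) : rdiv b a * a = b :=
  @Classical.epsilon_spec_aux G ⟨1⟩ (fun y => y * a = b) (h.existsUnique_rdiv a b).exists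

theorem ldiv_eq (h : IsLoop G) {a b x : G} (hx : a * x = b) : ldiv a b = x :=
  h.mul_left_cancel ((h.mul_ldiv a b).trans hx.symm)

theorem rdiv_eq (h : IsLoop G) {a b y : G} (hy : y * a = b) : rdiv b a = y :=
  h.mul_right_cancel ((h.rdiv_mul b a).trans hy.symm)

/-- Division closure of a subset of a loop can be checked on the chosen quotients. -/
theorem isSubloop (h : IsLoop G) {S : Set G} (h1 : (1 : G) ∈ S)
    (hmul : ∀ a ∈ S, ∀ b ∈ S, a * b ∈ S) (hl : ∀ a ∈ S, ∀ b ∈ S, ldiv a b ∈ S)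
    (hr : ∀ a ∈ S, ∀ b ∈ S, rdiv b a ∈ S) : IsSubloop S where
  one_mem := h1
  mul_mem := hmul
  ldiv_mem a ha b hb _ hx := h.ldiv_eq hx ▸ hl a ha b hb
  rdiv_mem a ha b hb _ hy := h.rdiv_eq hy ▸ hr a ha b hb

/-- The inverse of a central element is central. -/
theorem center_of_mul_eq_one (h : IsLoop G) {z z' : G} (hz : z ∈ Set.center G)
    (hzz : z * z' = 1) : z' ∈ Set.center G := by
  have hc : ∀ a, z * a = a * z := hz.comm
  have hl : ∀ a, z * (z' * a) = a := fun a => by rw [hz.left_assoc, hzz, h.one_mul]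
  have hr : ∀ a, z * (a * z') = a := fun a => by
    rw [hz.left_assoc, hc, hz.mid_assoc, hzz, h.mul_one]
  refine ⟨fun a => h.mul_left_cancel (a := z) ?_, fun a b => h.mul_left_cancel (a := z) ?_,
    fun a b => h.mul_left_cancel (a := z) ?_⟩
  · rw [hl, hr]
  · rw [hl, hz.left_assoc, hl]
  · rw [hr, hz.left_assoc, hc, hz.mid_assoc, hr]

theorem isSubloop_center (h : IsLoop G) : IsSubloop (Set.center G) := by
  have hinv : ∀ a ∈ Set.center G, ∃ a' ∈ Set.center G, a * a' = 1 := fun a ha =>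
    ⟨_, h.center_of_mul_eq_one ha (h.mul_ldiv a 1), h.mul_ldiv a 1⟩
  have hone : (1 : G) ∈ Set.center G :=
    ⟨fun a => by rw [Commute, SemiconjBy, h.one_mul, h.mul_one],
      fun a b => by simp only [h.one_mul], fun a b => by simp only [h.mul_one]⟩
  refine ⟨hone, fun a ha b hb => Set.mul_mem_center ha hb, ?_, ?_⟩
  · intro a ha b hb x hx
    obtain ⟨a', ha', haa⟩ := hinv a ha
    have : x = a' * b := h.mul_left_cancel (a := a) (by
      rw [hx, ha.left_assoc, haa, h.one_mul])
    exact this ▸ Set.mul_mem_center ha' hb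
  · intro a ha b hb x hx
    obtain ⟨a', ha', haa⟩ := hinv a ha
    have : x = a' * b := h.mul_left_cancel (a := a) (by
      rw [ha.comm x, hx, ha.left_assoc, haa, h.one_mul])
    exact this ▸ Set.mul_mem_center ha' hb

end IsLoop

theorem generated_subset {G : Type*} [Mul G] [One G] {X S : Set G} (hS : IsSubloop S)
    (hX : X ⊆ S) : generated X ⊆ S := fun _ hx => hx S hS hX

theorem subset_generated {G : Type*} [Mul G] [One G] (X : Set G) : X ⊆ generated X :=
  fun _ hx _ _ hX => hX hx

theorem isSubloop_generated {G : Type*} [Mul G] [One G] (X : Set G) : IsSubloop (generated X) where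
  one_mem _ hS _ := hS.one_mem
  mul_mem a ha b hb S hS hX := hS.mul_mem a (ha S hS hX) b (hb S hS hX)
  ldiv_mem a ha b hb x hx S hS hX := hS.ldiv_mem a (ha S hS hX) b (hb S hS hX) x hx
  rdiv_mem a ha b hb x hx S hS hX := hS.rdiv_mem a (ha S hS hX) b (hb S hS hX) x hx

theorem IsSubloop.rdiv {G : Type*} [Mul G] [One G] {S : Set G} (hS : IsSubloop S) (hG : IsLoop G)
    {a b : G} (ha : a ∈ S) (hb : b ∈ S) : rdiv b a ∈ S :=
  hS.rdiv_mem a ha b hb _ (hG.rdiv_mul b a)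

theorem IsSubloop.ldiv {G : Type*} [Mul G] [One G] {S : Set G} (hS : IsSubloop S) (hG : IsLoop G)
    {a b : G} (ha : a ∈ S) (hb : b ∈ S) : ldiv a b ∈ S :=
  hS.ldiv_mem a ha b hb _ (hG.mul_ldiv a b)

theorem IsSubloop.loopComm {G : Type*} [Mul G] [One G] {S : Set G} (hS : IsSubloop S)
    (hG : IsLoop G) {a b : G} (ha : a ∈ S) (hb : b ∈ S) : loopComm a b ∈ S :=
  hS.mul_mem _ (hS.rdiv hG ha hS.one_mem) _
    (hS.mul_mem _ (hS.rdiv hG hb hS.one_mem) _ (hS.mul_mem _ ha _ hb))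

theorem IsSubloop.assocFactor {G : Type*} [Mul G] [One G] {S : Set G} (hS : IsSubloop S)
    (hG : IsLoop G) {a b c : G} (ha : a ∈ S) (hb : b ∈ S) (hc : c ∈ S) : assocFactor a b c ∈ S :=
  hS.rdiv hG (hS.mul_mem _ ha _ (hS.mul_mem _ hb _ hc)) (hS.mul_mem _ (hS.mul_mem _ ha _ hb) _ hc)

theorem IsMetagroup.assocFactor_mem_center {G : Type*} [Mul G] [One G] (hG : IsMetagroup G)
    (a b c : G) : assocFactor a b c ∈ Set.center G := by
  obtain ⟨t, ht, h⟩ := hG.assoc a b c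
  exact (show assocFactor a b c = t from hG.rdiv_eq h.symm) ▸ ht

theorem IsMetagroup.Zm_subset_center {G : Type*} [Mul G] [One G] (hG : IsMetagroup G) :
    Zm G ⊆ Set.center G :=
  generated_subset hG.isSubloop_center (by
    rintro _ ⟨a, b, c, rfl⟩
    exact hG.assocFactor_mem_center a b c)

theorem center_mul_mul_center_mul {G : Type*} [Mul G] {x y : G} (hx : x ∈ Set.center G)
    (hy : y ∈ Set.center G) (a b : G) : (x * a) * (y * b) = (x * y) * (a * b) := by
  rw [← hx.left_assoc, ← hy.left_comm, hx.left_assoc]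

/-- The associator is unchanged when its arguments are multiplied by central elements. -/
theorem IsLoop.assocFactor_center_mul {G : Type*} [Mul G] [One G] (hG : IsLoop G)
    {x y z : G} (hx : x ∈ Set.center G) (hy : y ∈ Set.center G) (hz : z ∈ Set.center G)
    (a b c : G) : assocFactor (x * a) (y * b) (z * c) = assocFactor a b c := by
  have hxy := Set.mul_mem_center hx hy
  refine hG.rdiv_eq ?_
  rw [center_mul_mul_center_mul hx hy, center_mul_mul_center_mul hxy hz,
    center_mul_mul_center_mul hy hz, center_mul_mul_center_mul hx (Set.mul_mem_center hy hz),
    hx.left_assoc y z, ← (Set.mul_mem_center hxy hz).left_comm]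
  congr 1
  exact hG.rdiv_mul _ _

/-! ### Groups as metagroups; transport along isomorphisms. -/

theorem IsMetagroup.of_group (G : Type*) [Group G] : IsMetagroup G where
  existsUnique_ldiv a b := ⟨a⁻¹ * b, by simp, fun y hy => by simp [← hy]⟩
  existsUnique_rdiv a b := ⟨b * a⁻¹, by simp, fun y hy => by simp [← hy]⟩
  one_mul := _root_.one_mul
  mul_one := _root_.mul_one
  assoc a b c := ⟨1, Set.one_mem_center, by rw [_root_.one_mul, mul_assoc]⟩

theorem Zm_of_group (G : Type*) [Group G] : Zm G ⊆ {1} := by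
  have h := IsMetagroup.of_group G
  refine generated_subset ⟨rfl, ?_, ?_, ?_⟩ ?_
  · rintro _ rfl _ rfl; simp
  · rintro _ rfl _ rfl x hx; simpa using hx
  · rintro _ rfl _ rfl x hx; simpa using hx
  · rintro _ ⟨a, b, c, rfl⟩
    exact h.rdiv_eq (by rw [one_mul, mul_assoc])

theorem MulEquiv.mem_center {G H : Type*} [Mul G] [Mul H] (e : G ≃* H) {x : G} :
    e x ∈ Set.center H ↔ x ∈ Set.center G := by
  constructor
  · intro h
    refine ⟨fun a => e.injective ?_, fun a b => e.injective ?_, fun a b => e.injective ?_⟩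
    · simpa using (h.comm (e a)).eq
    · simpa using h.left_assoc (e a) (e b)
    · simpa using h.right_assoc (e a) (e b)
  · intro h
    refine ⟨fun a => e.symm.injective ?_, fun a b => e.symm.injective ?_,
      fun a b => e.symm.injective ?_⟩
    · simpa using (h.comm (e.symm a)).eq
    · simpa using h.left_assoc (e.symm a) (e.symm b)
    · simpa using h.right_assoc (e.symm a) (e.symm b)

theorem IsMetagroup.of_mulEquiv {G H : Type*} [MulOneClass G] [MulOneClass H] (hG : IsMetagroup G)
    (e : G ≃* H) : IsMetagroup H where
  existsUnique_ldiv a b := by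
    refine ⟨e (ldiv (e.symm a) (e.symm b)), ?_, fun y hy => ?_⟩
    · refine e.symm.injective ?_
      simpa using hG.mul_ldiv (e.symm a) (e.symm b)
    · rw [hG.ldiv_eq (x := e.symm y) (by rw [← hy, map_mul]), e.apply_symm_apply]
  existsUnique_rdiv a b := by
    refine ⟨e (rdiv (e.symm b) (e.symm a)), ?_, fun y hy => ?_⟩
    · refine e.symm.injective ?_
      simpa using hG.rdiv_mul (e.symm b) (e.symm a)
    · rw [hG.rdiv_eq (y := e.symm y) (by rw [← hy, map_mul]), e.apply_symm_apply]
  one_mul := _root_.one_mul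
  mul_one := _root_.mul_one
  assoc a b c := by
    obtain ⟨t, ht, h⟩ := hG.assoc (e.symm a) (e.symm b) (e.symm c)
    refine ⟨e t, e.mem_center.2 ht, e.symm.injective ?_⟩
    simpa using h

theorem IsCentralMetagroup.of_mulEquiv {G H : Type*} [MulOneClass G] [MulOneClass H]
    (hG : IsCentralMetagroup G) (e : G ≃* H) : IsCentralMetagroup H where
  toIsMetagroup := hG.toIsMetagroup.of_mulEquiv e
  comm a b := by
    obtain ⟨t, ht, h⟩ := hG.comm (e.symm a) (e.symm b)
    refine ⟨e t, e.mem_center.2 ht, e.symm.injective ?_⟩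
    simpa using h

/-! ### The group `D/Z(D)`. -/

/-- The quotient of a metagroup by its center is a group. -/
theorem IsMetagroup.exists_central_quotient {D : Type u} [MulOneClass D] (hD : IsMetagroup D) :
    ∃ (Q : Type u) (_ : Group Q) (π : D →* Q), Function.Surjective π ∧
      ∀ a b, π a = π b ↔ ∃ z ∈ Set.center D, a = z * b := by
  let c : Con D :=
    { r := fun a b => ∃ z ∈ Set.center D, a = z * b
      iseqv := by
        refine ⟨fun a => ⟨1, Set.one_mem_center, (one_mul a).symm⟩, ?_, ?_⟩
        · rintro a b ⟨z, hz, rfl⟩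
          refine ⟨ldiv z 1, hD.center_of_mul_eq_one hz (hD.mul_ldiv z 1), ?_⟩
          rw [(hD.center_of_mul_eq_one hz (hD.mul_ldiv z 1)).left_assoc, ← (hz.comm _ : _ = _),
            hD.mul_ldiv, one_mul]
        · rintro a b d ⟨z, hz, rfl⟩ ⟨w, hw, rfl⟩
          exact ⟨z * w, Set.mul_mem_center hz hw, hz.left_assoc _ _⟩
      mul' := by
        rintro _ a _ b ⟨x, hx, rfl⟩ ⟨y, hy, rfl⟩
        exact ⟨x * y, Set.mul_mem_center hx hy, center_mul_mul_center_mul hx hy a b⟩ }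
  let grp : Group c.Quotient :=
    { c.mulOneClass with
      mul_assoc := by
        rintro ⟨x⟩ ⟨y⟩ ⟨z⟩
        -- The defining identity of a metagroup is associativity modulo the center.
        exact c.eq.2 (hD.assoc x y z)
      inv := fun q => ((rdiv 1 (Quotient.out q) : D) : c.Quotient)
      inv_mul_cancel := fun q => by
        have h : ((Quotient.out q : D) : c.Quotient) = q := Quotient.out_eq q
        have h' := congrArg (fun d : D => (d : c.Quotient)) (hD.rdiv_mul 1 (Quotient.out q))
        exact (congrArg (fun t => ((rdiv 1 (Quotient.out q) : D) : c.Quotient) * t) h.symm).trans h' }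
  refine ⟨c.Quotient, grp, ⟨⟨fun d => (d : c.Quotient), rfl⟩, fun _ _ => rfl⟩, ?_, ?_⟩
  · rintro ⟨x⟩; exact ⟨x, rfl⟩
  · intro a b; exact c.eq

/-! ### A Heisenberg group of functions. -/

/-- The group of pairs `(a, c)` with `a : X → R`, `c : X × X → R` and the multiplication
`(a, c) (a', c') = (a + a', c + c' + a ⊗ a')`. -/
@[ext]
structure HeisenbergFun (X R : Type*) where
  fst : X → R
  snd : X → X → R

namespace HeisenbergFun

variable {X R : Type*} [CommRing R]

instance : Mul (HeisenbergFun X R) :=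
  ⟨fun p q => ⟨fun x => p.fst x + q.fst x, fun x y => p.snd x y + q.snd x y + p.fst x * q.fst y⟩⟩

instance : One (HeisenbergFun X R) := ⟨⟨fun _ => 0, fun _ _ => 0⟩⟩

instance : Inv (HeisenbergFun X R) :=
  ⟨fun p => ⟨fun x => -p.fst x, fun x y => -p.snd x y + p.fst x * p.fst y⟩⟩

@[simp] theorem mul_fst (p q : HeisenbergFun X R) (x : X) :
    (p * q).fst x = p.fst x + q.fst x := rfl

@[simp] theorem mul_snd (p q : HeisenbergFun X R) (x y : X) :
    (p * q).snd x y = p.snd x y + q.snd x y + p.fst x * q.fst y := rfl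

@[simp] theorem one_fst (x : X) : (1 : HeisenbergFun X R).fst x = 0 := rfl

@[simp] theorem one_snd (x y : X) : (1 : HeisenbergFun X R).snd x y = 0 := rfl

@[simp] theorem inv_fst (p : HeisenbergFun X R) (x : X) : (p⁻¹).fst x = -p.fst x := rfl

@[simp] theorem inv_snd (p : HeisenbergFun X R) (x y : X) :
    (p⁻¹).snd x y = -p.snd x y + p.fst x * p.fst y := rfl

instance : Group (HeisenbergFun X R) :=
  Group.ofLeftAxioms
    (fun p q r => by ext <;> simp <;> ring)
    (fun p => by ext <;> simp)
    (fun p => by ext <;> simp)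

/-- The two products differ only by `a ⊗ a'` against `a' ⊗ a` in the second component. So
commutation depends on first components alone, and the group has class at most two. -/
theorem mul_comm_iff (p q : HeisenbergFun X R) :
    p * q = q * p ↔ ∀ x y, p.fst x * q.fst y = q.fst x * p.fst y := by
  constructor
  · intro h x y
    have := congrFun (congrFun (congrArg snd h) x) y
    simp only [mul_snd] at this
    linear_combination this
  · intro h
    ext x y
    · simp [add_comm]
    · simp only [mul_snd, h x y]; ring

theorem commute_of_fst_eq_zero {p : HeisenbergFun X R} (hp : ∀ x, p.fst x = 0)
    (q : HeisenbergFun X R) : p * q = q * p := by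
  simp [mul_comm_iff, hp]

@[simp] theorem pow_fst (p : HeisenbergFun X R) (n : ℕ) (x : X) :
    (p ^ n).fst x = n * p.fst x := by
  induction n with
  | zero => simp
  | succ n ih => rw [pow_succ, mul_fst, ih]; push_cast; ring

/-- The action of a group `Q` on `HeisenbergFun Q R` by translations. -/
def translate (Q R : Type*) [Group Q] [CommRing R] : Q →* MulAut (HeisenbergFun Q R) where
  toFun q :=
    { toFun := fun p => ⟨fun x => p.fst (x * q), fun x y => p.snd (x * q) (y * q)⟩
      invFun := fun p => ⟨fun x => p.fst (x * q⁻¹), fun x y => p.snd (x * q⁻¹) (y * q⁻¹)⟩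
      left_inv := fun p => by simp
      right_inv := fun p => by simp
      map_mul' := fun p p' => rfl }
  map_one' := by ext <;> simp
  map_mul' q q' := by ext <;> simp [mul_assoc]

@[simp] theorem translate_fst {Q : Type*} [Group Q] (q : Q) (p : HeisenbergFun Q R) (x : Q) :
    (translate Q R q p).fst x = p.fst (x * q) := rfl

end HeisenbergFun

/-! ### Class-two groups with an action of `Q`. -/

/-- A group of class at most two with an action of `Q` that is generated by one orbit. -/
theorem exists_orbit_generated {Q W : Type u} [Group Q] [Group W] (ρ : Q →* MulAut W) (w : W) :
    ∃ (B : Type u) (_ : Group B) (σ : Q →* MulAut B) (i : B →* W) (m : B),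
      Function.Injective i ∧ i m = w ∧ (∀ q b, i (σ q b) = ρ q (i b)) ∧
      ∀ K : Subgroup B, (∀ q, σ q m ∈ K) → K = ⊤ := by
  let B : Subgroup W := Subgroup.closure (Set.range fun q => ρ q w)
  have hB : ∀ q, ∀ b ∈ B, ρ q b ∈ B := by
    intro q b hb
    induction hb using Subgroup.closure_induction with
    | mem x hx =>
      obtain ⟨q', rfl⟩ := hx
      exact Subgroup.subset_closure ⟨q * q', by simp⟩
    | one => simp
    | mul x y _ _ hx hy => rw [map_mul]; exact mul_mem hx hy
    | inv x _ hx => rw [map_inv]; exact inv_mem hx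
  let σ : Q →* MulAut B :=
    { toFun := fun q =>
        { toFun := fun b => ⟨ρ q b, hB q b b.2⟩
          invFun := fun b => ⟨ρ q⁻¹ b, hB q⁻¹ b b.2⟩
          left_inv := fun b => by simp
          right_inv := fun b => by simp
          map_mul' := fun a b => by ext; simp }
      map_one' := by ext; simp
      map_mul' := fun q q' => by ext; simp }
  have hm : w ∈ B := Subgroup.subset_closure ⟨1, by simp⟩
  refine ⟨B, inferInstance, σ, B.subtype, ⟨w, hm⟩, B.subtype_injective, rfl, fun _ _ => rfl, ?_⟩
  intro K hK
  have : B ≤ K.map B.subtype := by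
    refine (Subgroup.closure_le _).2 ?_
    rintro _ ⟨q, rfl⟩
    exact ⟨_, hK q, rfl⟩
  rw [eq_top_iff]
  rintro ⟨b, hb⟩ -
  obtain ⟨k, hk, hkb⟩ := this hb
  exact (Subtype.ext hkb : k = ⟨b, hb⟩) ▸ hk

/-- With `u` the indicator function of `S` and `f x = u x - u (x * g)`, these conditions say that
`u` is invariant under right translation by `g ^ n`, that `f 1 = 1`, and that `f h = 0`. -/
theorem exists_subgroup_of_ne_one {Q : Type*} [Group Q] {g h₀ : Q} (hg : g ≠ 1) (h1 : h₀ ≠ 1)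
    (hg0 : h₀ ≠ g) : ∃ (S : Subgroup Q) (n : ℕ) (h : Q), n ≠ 0 ∧ g ∉ S ∧ g ^ n ∈ S ∧
      h ∉ S ∧ h * g ∉ S := by
  by_cases hfin : IsOfFinOrder g
  · refine ⟨⊥, orderOf g, h₀⁻¹, hfin.orderOf_pos.ne', by simpa using hg, by simp [pow_orderOf_eq_one],
      by simpa using h1, ?_⟩
    rw [Subgroup.mem_bot, inv_mul_eq_one]
    exact hg0
  · have hinj := injective_zpow_iff_not_isOfFinOrder.2 hfin
    have key : ∀ i : ℕ, g ^ i ∈ Subgroup.zpowers (g ^ 3) → (3 : ℤ) ∣ i := by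
      rintro i ⟨k, hk⟩
      refine ⟨k, (hinj ?_).symm⟩
      simpa [zpow_mul] using hk
    -- The exponent 3 is the least that keeps both `g` and `g ^ 2` out of the subgroup, so that `h =
    -- g` is allowed.
    refine ⟨Subgroup.zpowers (g ^ 3), 3, g, by norm_num, fun h => ?_, Subgroup.mem_zpowers _,
      fun h => ?_, fun h => ?_⟩
    · have := key 1 (by simpa using h); norm_num at this
    · have := key 1 (by simpa using h); norm_num at this
    · have := key 2 (by simpa [pow_two] using h); norm_num at this

/-- A nonabelian group of class two on which a given `g ≠ 1` in `Q` acts so that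
`m⁻¹ * g m` generates it modulo the center as a group with an action of `Q`. -/
theorem exists_action_of_ne_one {Q : Type u} [Group Q] {g h₀ : Q} (hg : g ≠ 1) (h1 : h₀ ≠ 1)
    (hg0 : h₀ ≠ g) :
    ∃ (B : Type u) (_ : Group B) (ρ : Q →* MulAut B) (m : B),
      (∀ a b : B, a * b * a⁻¹ * b⁻¹ ∈ Subgroup.center B) ∧ (∃ a b : B, a * b ≠ b * a) ∧
      ∀ K : Subgroup B, Subgroup.center B ≤ K → (∀ q, ∀ b ∈ K, ρ q b ∈ K) →
        m⁻¹ * ρ g m ∈ K → K = ⊤ := by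
  classical
  obtain ⟨S, n, h, hn, hgS, hgn, hhS, hhg⟩ := exists_subgroup_of_ne_one hg h1 hg0
  -- The modulus is chosen coprime to `n`: `m ^ n` and `m ^ (n + 1)` in `K` together give `m ∈ K`.
  -- It exceeds 1, so `1 ≠ 0` in `R`.
  let R := ZMod (n + 1)
  have : Fact (1 < n + 1) := ⟨by omega⟩
  let u : Q → R := fun x => if x ∈ S then 1 else 0
  let f : Q → R := fun x => u x - u (x * g)
  let w : HeisenbergFun Q R := ⟨f, fun _ _ => 0⟩
  have hf1 : f 1 = 1 := by simp [f, u, one_mem, hgS]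
  have hfh : f h = 0 := by simp [f, u, hhS, hhg]
  have hun : ∀ x, u (x * g ^ n) = u x := fun x => by
    simp only [u, Subgroup.mul_mem_cancel_right S hgn]
  obtain ⟨B, _, ρ, i, m, hi, him, hρ, htop⟩ :=
    exists_orbit_generated (HeisenbergFun.translate Q R) w
  have hcen : ∀ p : B, (∀ x, (i p).fst x = 0) → p ∈ Subgroup.center B := fun p hp =>
    Subgroup.mem_center_iff.2 fun q => hi (by
      rw [map_mul, map_mul, HeisenbergFun.commute_of_fst_eq_zero hp])
  have hcomm : ∀ a b : B, a * b * a⁻¹ * b⁻¹ ∈ Subgroup.center B := fun a b => hcen _ fun x => by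
    simp
  refine ⟨B, inferInstance, ρ, m, hcomm, ⟨m, ρ h m, fun e => ?_⟩, ?_⟩
  -- At `(1, h⁻¹)` the two tensors are `f 1 * f 1 = 1` and `f h * f h⁻¹ = 0`.
  · have := (HeisenbergFun.mul_comm_iff _ _).1 (by simpa using congrArg i e) 1 h⁻¹
    simp [hρ, him, w, hf1, hfh] at this
  · intro K hK hinv hmK
    have : K.Normal := ⟨fun k hk b => by
      have := mul_mem (hK (hcomm b k)) hk
      simpa using this⟩
    -- Consecutive translates differ by `g ^ j` applied to `m⁻¹ * g m`, which stays in `K`.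
    have hmk : ∀ j : ℕ, ((ρ (g ^ j) m : B) : B ⧸ K) = m := by
      intro j
      induction j with
      | zero => simp
      | succ j ih =>
        rw [← ih, eq_comm, QuotientGroup.eq]
        have := hinv (g ^ j) _ hmK
        simpa [pow_succ] using this
    -- `P j` is the product of the `g ^ i (m)` for `i < j`; its first component telescopes.
    let P : ℕ → B := fun j => Nat.rec 1 (fun j p => p * ρ (g ^ j) m) j
    have hP : ∀ j, P (j + 1) = P j * ρ (g ^ j) m := fun _ => rfl
    have hPmk : ∀ j, (QuotientGroup.mk (P j) : B ⧸ K) = (m : B ⧸ K) ^ j := by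
      intro j
      induction j with
      | zero => simp [P]
      | succ j ih => rw [hP, QuotientGroup.mk_mul, ih, hmk, pow_succ]
    have hPfst : ∀ j x, (i (P j)).fst x = u x - u (x * g ^ j) := by
      intro j x
      induction j with
      | zero => simp [P]
      | succ j ih =>
        rw [hP, map_mul, HeisenbergFun.mul_fst, ih, hρ, HeisenbergFun.translate_fst, him]
        simp [w, f, pow_succ, mul_assoc]
    have hPn : P n ∈ K := hK (hcen _ fun x => by rw [hPfst, hun, sub_self])
    have hmn : m ^ n ∈ K := by
      rw [← QuotientGroup.eq_one_iff, QuotientGroup.mk_pow, ← hPmk]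
      exact (QuotientGroup.eq_one_iff _).2 hPn
    have hmn1 : m ^ (n + 1) ∈ K := hK (hcen _ fun x => by simp [R])
    have hm : m ∈ K := by
      have := mul_mem (inv_mem hmn) hmn1
      simpa [pow_succ] using this
    exact htop K fun q => hinv q m hm

/-! ### The extension `C*` as a semidirect product. -/

/-- A metagroup `D` acting on a group `B` through a quotient group of `D` with kernel the center,
and a common subgroup `Z` of the centers of `D` (onto) and `B` (fixed by the action). -/
structure CentralAction (D Q B Z : Type*) [MulOneClass D] [Group Q] [Group B] [CommGroup Z] where
  isMetagroup : IsMetagroup D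
  π : D →* Q
  π_surjective : Function.Surjective π
  π_eq : ∀ a b, π a = π b ↔ ∃ z ∈ Set.center D, a = z * b
  ρ : Q →* MulAut B
  jZ : Z →* D
  jZ_injective : Function.Injective jZ
  range_jZ : Set.range jZ = Set.center D
  jB : Z →* B
  jB_injective : Function.Injective jB
  jB_center : ∀ γ, jB γ ∈ Set.center B
  ρ_jB : ∀ q γ, ρ q (jB γ) = jB γ

/-- The transversal `{e}` of `D` in itself. -/
def RightTransversal.trivial (D : Type*) [MulOneClass D] :
    RightTransversal (⊤ : Submonoid D) where
  carrier := {1}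
  one_mem := rfl
  existsUnique a := by
    refine ⟨(⟨a, Submonoid.mem_top a⟩, ⟨1, rfl⟩), (mul_one a).symm, ?_⟩
    rintro ⟨⟨b, hb⟩, ⟨c, hc⟩⟩ h
    obtain rfl : c = 1 := hc
    obtain rfl : a = b := by simpa using h
    rfl

theorem IsMetagroup.top {D : Type*} [MulOneClass D] (hD : IsMetagroup D) :
    IsMetagroup (⊤ : Submonoid D) :=
  hD.of_mulEquiv Submonoid.topEquiv.symm

namespace CentralAction

variable {D Q B Z : Type*} [MulOneClass D] [Group Q] [Group B] [CommGroup Z]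
  (T : CentralAction D Q B Z)

theorem π_center {z : D} (hz : z ∈ Set.center D) : T.π z = 1 := by
  rw [← T.π.map_one, T.π_eq]
  exact ⟨z, hz, (mul_one z).symm⟩

/-- The smashing factors with `A = D` and `η = κ = ξ = e`. (As `f ↦ f^{d}` translates by `d \ e` on
the right, `(f^{d})^{d₁}` and `f^{d₁ d}` move the support of `f` in the same way only if `A` contains
the commutators of `D`; the choice `A = D` serves all metagroups `D` at once.) -/
def smashingFactors : SmashingFactors (⊤ : Submonoid D) B Z where
  jA := (Submonoid.topEquiv.symm : D ≃* (⊤ : Submonoid D)).toMonoidHom.comp T.jZ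
  jB := T.jB
  jA_injective := Submonoid.topEquiv.symm.injective.comp T.jZ_injective
  jB_injective := T.jB_injective
  jA_center γ := by
    refine (MulEquiv.mem_center Submonoid.topEquiv.symm).2 ?_
    rw [← T.range_jZ]
    exact ⟨γ, rfl⟩
  jB_center := T.jB_center
  Zm_A x hx := by
    have h := (MulEquiv.mem_center Submonoid.topEquiv).2 (T.isMetagroup.top.Zm_subset_center hx)
    rw [← T.range_jZ] at h
    obtain ⟨γ, hγ⟩ := h
    exact ⟨γ, Subtype.ext hγ⟩
  Zm_B := (Zm_of_group B).trans (by rintro _ rfl; exact ⟨1, T.jB.map_one⟩)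
  φ a := (T.ρ (T.π a)).toEquiv
  η _ _ _ := 1
  κ _ _ _ := 1
  ξ _ _ := 1
  φ_φ v u b := by simp
  φ_one u := by simp
  one_φ b := by simp
  η_Z _ _ _ _ := rfl
  φ_mul u c b := by simp
  κ_Z_left _ _ _ _ := rfl
  κ_Z_right _ _ _ _ := rfl
  κ_Z_one _ _ _ := rfl
  κ_one_Z _ _ _ := rfl
  ξ_Z_left _ _ _ _ _ := rfl
  ξ_Z_right _ _ _ _ _ := rfl
  ξ_Z_one _ _ _ := rfl
  ξ_one_Z _ _ _ := rfl
  φ_Z a γ := T.ρ_jB _ γ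
  Z_φ γ b := by
    have : T.π (T.jZ γ) = 1 := T.π_center (T.range_jZ ▸ ⟨γ, rfl⟩)
    simp [this]

instance : Unique (RightTransversal.trivial D).carrier := Set.uniqueSingleton (1 : D)

/-- `F*` is a copy of `B`. -/
def fstarEquiv (D B : Type*) [MulOneClass D] [Group B] :
    B ≃* (RightTransversal.trivial D).FStar B where
  toFun b := ⟨fun _ => b, Set.toFinite _⟩
  invFun f := f.1 default
  left_inv _ := rfl
  right_inv f := by
    ext v
    exact congrArg f.1 (Subsingleton.elim _ _)
  map_mul' _ _ := rfl

theorem closed : T.smashingFactors.Closed (RightTransversal.trivial D) :=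
  fun _ _ _ _ _ _ => Set.toFinite _

/-- `C*`, in which `D` acts on a copy of `B`. -/
abbrev Ext : Type _ := T.smashingFactors.CStar (RightTransversal.trivial D) T.closed

/-- The element of `C*` with the components `d` and `b`. -/
def pair (d : D) (b : B) : T.Ext := ⟨d, fstarEquiv D B b⟩

theorem exists_eq_pair (x : T.Ext) : ∃ d b, x = T.pair d b := by
  obtain ⟨d, f⟩ := x
  exact ⟨d, (fstarEquiv D B).symm f, by simp [pair]⟩

theorem pair_inj {d d' : D} {b b' : B} : T.pair d b = T.pair d' b' ↔ d = d' ∧ b = b' := by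
  simp [pair, SmashingFactors.CStar.ext_iff]

theorem ψ_trivial (a : D) : ((RightTransversal.trivial D).ψ a : D) = a := by
  have h : a = ((RightTransversal.trivial D).existsUnique a).choose.1 *
      (((RightTransversal.trivial D).existsUnique a).choose.2 : D) :=
    ((RightTransversal.trivial D).existsUnique a).choose_spec.1
  have h1 : (((RightTransversal.trivial D).existsUnique a).choose.2 : D) = 1 :=
    ((RightTransversal.trivial D).existsUnique a).choose.2.2
  rw [h1, mul_one] at h
  exact h.symm

theorem π_rdiv (a b : D) : T.π (rdiv a b) = T.π a * (T.π b)⁻¹ := by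
  rw [eq_mul_inv_iff_mul_eq, ← map_mul, T.isMetagroup.rdiv_mul]

theorem π_ldiv (a b : D) : T.π (ldiv a b) = (T.π a)⁻¹ * T.π b := by
  rw [eq_inv_mul_iff_mul_eq, ← map_mul, T.isMetagroup.mul_ldiv]

/-- In `D` the element `e/(e/d)` need only agree with `d` modulo the center; this suffices, since
`D` acts through `Q`. -/
theorem π_s_trivial (d : D) (v : (RightTransversal.trivial D).carrier) :
    T.π ((RightTransversal.trivial D).s d v) = T.π d := by
  have hv : (v : D) = 1 := v.2
  have h := congrArg (fun x : (⊤ : Submonoid D) => T.π x)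
    (T.isMetagroup.top.rdiv_mul 1 ((RightTransversal.trivial D).ψ (rdiv (v : D) d)))
  simp only [Submonoid.coe_mul, map_mul, ψ_trivial, π_rdiv, Submonoid.coe_one, map_one] at h
  rw [hv, map_one, one_mul] at h
  rw [RightTransversal.s, hv]
  exact mul_inv_eq_one.1 h

theorem pair_mul_pair (d d' : D) (b b' : B) :
    T.pair d b * T.pair d' b' = T.pair (d * d') (b * T.ρ (T.π d) b') := by
  refine SmashingFactors.CStar.ext rfl (Subtype.ext (funext fun v => ?_))
  change T.jB 1 * (b * T.ρ (T.π ((RightTransversal.trivial D).s d v)) b') = b * T.ρ (T.π d) b'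
  rw [T.π_s_trivial, map_one, one_mul]

theorem pair_one : T.pair 1 1 = 1 := rfl

end CentralAction

/-! ### Metagroup structure and commutators of `C*`. -/

namespace CentralAction

variable {D Q B Z : Type*} [MulOneClass D] [Group Q] [Group B] [CommGroup Z]
  (T : CentralAction D Q B Z)

theorem pair_mem_center {z : D} (hz : z ∈ Set.center D) : T.pair z 1 ∈ Set.center T.Ext := by
  have hπ := T.π_center hz
  refine ⟨fun a => ?_, fun a b => ?_, fun a b => ?_⟩
  · obtain ⟨a, x, rfl⟩ := T.exists_eq_pair a
    rw [Commute, SemiconjBy, pair_mul_pair, pair_mul_pair, pair_inj]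
    exact ⟨hz.comm a, by simp [hπ]⟩
  · obtain ⟨a, x, rfl⟩ := T.exists_eq_pair a
    obtain ⟨b, y, rfl⟩ := T.exists_eq_pair b
    simp only [pair_mul_pair, pair_inj]
    exact ⟨hz.left_assoc a b, by simp [hπ]⟩
  · obtain ⟨a, x, rfl⟩ := T.exists_eq_pair a
    obtain ⟨b, y, rfl⟩ := T.exists_eq_pair b
    simp only [pair_mul_pair, pair_inj]
    exact ⟨hz.right_assoc a b, by simp⟩

theorem isMetagroup_ext : IsMetagroup T.Ext where
  existsUnique_ldiv a b := by
    obtain ⟨a, x, rfl⟩ := T.exists_eq_pair a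
    obtain ⟨b, y, rfl⟩ := T.exists_eq_pair b
    refine ⟨T.pair (ldiv a b) ((T.ρ (T.π a))⁻¹ (x⁻¹ * y)), ?_, fun c hc => ?_⟩
    · simp only [pair_mul_pair, pair_inj, T.isMetagroup.mul_ldiv, true_and]
      rw [MulAut.apply_inv_self, mul_inv_cancel_left]
    · obtain ⟨c, w, rfl⟩ := T.exists_eq_pair c
      simp only [pair_mul_pair, pair_inj] at hc ⊢
      refine ⟨(T.isMetagroup.ldiv_eq hc.1).symm, ?_⟩
      rw [← hc.2, inv_mul_cancel_left, MulAut.inv_apply_self]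
  existsUnique_rdiv a b := by
    obtain ⟨a, x, rfl⟩ := T.exists_eq_pair a
    obtain ⟨b, y, rfl⟩ := T.exists_eq_pair b
    refine ⟨T.pair (rdiv b a) (y * (T.ρ (T.π (rdiv b a)) x)⁻¹), ?_, fun c hc => ?_⟩
    · simp only [pair_mul_pair, pair_inj, T.isMetagroup.rdiv_mul, true_and]
      rw [inv_mul_cancel_right]
    · obtain ⟨c, w, rfl⟩ := T.exists_eq_pair c
      simp only [pair_mul_pair, pair_inj] at hc ⊢
      have h := T.isMetagroup.rdiv_eq hc.1
      exact ⟨h.symm, by rw [h, ← hc.2, mul_inv_cancel_right]⟩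
  one_mul a := by
    obtain ⟨a, x, rfl⟩ := T.exists_eq_pair a
    rw [← pair_one, pair_mul_pair, pair_inj]
    simp
  mul_one a := by
    obtain ⟨a, x, rfl⟩ := T.exists_eq_pair a
    rw [← pair_one, pair_mul_pair, pair_inj]
    simp
  assoc a b c := by
    obtain ⟨a, x, rfl⟩ := T.exists_eq_pair a
    obtain ⟨b, y, rfl⟩ := T.exists_eq_pair b
    obtain ⟨c, z, rfl⟩ := T.exists_eq_pair c
    obtain ⟨t, ht, h⟩ := T.isMetagroup.assoc a b c
    refine ⟨T.pair t 1, T.pair_mem_center ht, ?_⟩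
    simp only [pair_mul_pair, pair_inj]
    exact ⟨h, by simp [T.π_center ht, mul_assoc]⟩

/-- As `B` is a group and `Q` acts on it by automorphisms, the second components associate. Thus a
subloop of `C*` yields associators of `D` whatever the `B`-components of its elements. -/
theorem assocFactor_pair (a b c : D) (x y z : B) :
    assocFactor (T.pair a x) (T.pair b y) (T.pair c z) = T.pair (assocFactor a b c) 1 := by
  refine T.isMetagroup_ext.rdiv_eq ?_
  have h : assocFactor a b c * (a * (b * c)) = a * b * c := T.isMetagroup.rdiv_mul _ _
  simp only [pair_mul_pair, pair_inj]
  exact ⟨h, by simp [T.π_center (T.isMetagroup.assocFactor_mem_center a b c), mul_assoc]⟩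

theorem rdiv_one_pair (a : D) (x : B) :
    rdiv 1 (T.pair a x) = T.pair (rdiv 1 a) ((T.ρ (T.π a))⁻¹ x⁻¹) := by
  refine T.isMetagroup_ext.rdiv_eq ?_
  rw [pair_mul_pair, ← pair_one, pair_inj]
  exact ⟨T.isMetagroup.rdiv_mul 1 a, by simp [T.π_rdiv]⟩

theorem loopComm_pair_one (b : B) (d : D) :
    loopComm (T.pair 1 b) (T.pair d 1) = T.pair 1 (b⁻¹ * (T.ρ (T.π d))⁻¹ b) := by
  simp only [loopComm, rdiv_one_pair, pair_mul_pair, pair_inj, T.π_rdiv]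
  have h1 : rdiv (1 : D) 1 = 1 := T.isMetagroup.rdiv_eq (mul_one 1)
  exact ⟨by rw [h1, one_mul, one_mul, T.isMetagroup.rdiv_mul], by simp⟩

/-- Two elements of `C*` over commuting elements of `D` produce in this way an element of `F*`. -/
theorem loopComm_pair (b : B) (a d : D) (hcomm : loopComm a d = 1) :
    loopComm (T.pair a b) (T.pair d 1) =
      T.pair 1 ((T.ρ (T.π a))⁻¹ (b⁻¹ * (T.ρ (T.π d))⁻¹ b)) := by
  have h : loopComm (T.pair a b) (T.pair d 1) =
      T.pair (loopComm a d) ((T.ρ (T.π a))⁻¹ (b⁻¹ * (T.ρ (T.π d))⁻¹ b)) := by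
    simp only [loopComm, rdiv_one_pair, pair_mul_pair, pair_inj, T.π_rdiv]
    simp
  rw [h, hcomm]

/-! ### Subloops of `C*`: projection to `D` and intersection with `F*`. -/

/-- The elements `(e, b)` in a subloop of `C*` form a subgroup. -/
def fiber {H : Set T.Ext} (hH : IsSubloop H) : Subgroup B where
  carrier := {b | T.pair 1 b ∈ H}
  one_mem' := hH.one_mem
  mul_mem' {a b} ha hb := by
    have := hH.mul_mem _ ha _ hb
    simpa [pair_mul_pair] using this
  inv_mem' {a} ha := by
    refine hH.ldiv_mem _ ha _ hH.one_mem _ ?_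
    rw [pair_mul_pair, ← pair_one, pair_inj]
    simp

theorem mem_fiber {H : Set T.Ext} (hH : IsSubloop H) {b : B} :
    b ∈ T.fiber hH ↔ T.pair 1 b ∈ H := Iff.rfl

theorem isSubloop_preimage (R : Subgroup Q) : IsSubloop (T.π ⁻¹' (R : Set Q)) :=
  T.isMetagroup.isSubloop (by simp [one_mem])
    (fun a ha b hb => by simpa using mul_mem ha hb)
    (fun a ha b hb => by simpa [T.π_ldiv] using mul_mem (inv_mem ha) hb)
    (fun a ha b hb => by simpa [T.π_rdiv] using mul_mem hb (inv_mem ha))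

/-- A subloop of `C*` which contains elements over the `d j \ e` projects onto `D`. -/
theorem exists_pair_mem {H : Set T.Ext} (hH : IsSubloop H) {J : Type*} {d : J → D}
    (hgen : generated (Zm D ∪ Set.range d) = Set.univ)
    (hd : ∀ j, ∃ b, T.pair (ldiv (d j) 1) b ∈ H) (a : D) : ∃ b, T.pair a b ∈ H := by
  have hG := T.isMetagroup_ext
  -- `Z_m(D)` is not assumed to lie in the projection of `H`. It disappears in `Q`, so the
  -- projection is first shown to be onto `Q`.
  let R : Subgroup Q :=
    { carrier := {q | ∃ a b, T.pair a b ∈ H ∧ T.π a = q}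
      one_mem' := ⟨1, 1, hH.one_mem, map_one _⟩
      mul_mem' := by
        rintro _ _ ⟨a, b, h, rfl⟩ ⟨a', b', h', rfl⟩
        exact ⟨_, _, T.pair_mul_pair a a' b b' ▸ hH.mul_mem _ h _ h', map_mul _ _ _⟩
      inv_mem' := by
        rintro _ ⟨a, b, h, rfl⟩
        exact ⟨_, _, T.rdiv_one_pair a b ▸ hH.rdiv hG.toIsLoop h hH.one_mem, by simp [T.π_rdiv]⟩ }
  have hR : ∀ a, T.π a ∈ R := by
    intro a
    have ha : a ∈ generated (Zm D ∪ Set.range d) := hgen ▸ Set.mem_univ a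
    refine ha _ (T.isSubloop_preimage R) (Set.union_subset ?_ ?_)
    · intro z hz
      have : T.π z = 1 := T.π_center (T.isMetagroup.Zm_subset_center hz)
      simp [this, one_mem]
    · rintro _ ⟨j, rfl⟩
      obtain ⟨b, hb⟩ := hd j
      have : T.π (ldiv (d j) 1) ∈ R := ⟨_, b, hb, rfl⟩
      simpa [T.π_ldiv] using this
  have hlift : ∀ a, ∃ z ∈ Set.center D, ∃ b, T.pair (z * a) b ∈ H := by
    intro a
    obtain ⟨a', b, h, e⟩ := hR a
    obtain ⟨z, hz, rfl⟩ := (T.π_eq _ _).1 e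
    exact ⟨z, hz, b, h⟩
  -- Associators ignore central factors, so lifts modulo the center are enough to find each
  -- `(t(a,b,c), e)` in `H`.
  have hZ : Zm D ⊆ {z | T.pair z 1 ∈ H} := by
    refine generated_subset ⟨hH.one_mem, ?_, ?_, ?_⟩ ?_
    · intro a ha b hb
      simpa [pair_mul_pair] using hH.mul_mem _ ha _ hb
    · intro a ha b hb x hx
      exact hH.ldiv_mem _ ha _ hb _ (by simp [pair_mul_pair, hx])
    · intro a ha b hb x hx
      exact hH.rdiv_mem _ ha _ hb _ (by simp [pair_mul_pair, hx])
    · rintro _ ⟨a, b, c, rfl⟩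
      obtain ⟨x, hx, a', ha⟩ := hlift a
      obtain ⟨y, hy, b', hb⟩ := hlift b
      obtain ⟨z, hz, c', hc⟩ := hlift c
      have := hH.assocFactor hG.toIsLoop ha hb hc
      rwa [assocFactor_pair, T.isMetagroup.assocFactor_center_mul hx hy hz] at this
  have hP : IsSubloop {a | ∃ b, T.pair a b ∈ H} := by
    refine ⟨⟨1, hH.one_mem⟩, ?_, ?_, ?_⟩
    · rintro a ⟨x, ha⟩ b ⟨y, hb⟩
      exact ⟨_, T.pair_mul_pair a b x y ▸ hH.mul_mem _ ha _ hb⟩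
    · rintro a ⟨x, ha⟩ b ⟨y, hb⟩ c hc
      exact ⟨(T.ρ (T.π a))⁻¹ (x⁻¹ * y), hH.ldiv_mem _ ha _ hb _ (by
        rw [pair_mul_pair, hc, MulAut.apply_inv_self, mul_inv_cancel_left])⟩
    · rintro a ⟨x, ha⟩ b ⟨y, hb⟩ c hc
      exact ⟨y * (T.ρ (T.π c) x)⁻¹, hH.rdiv_mem _ ha _ hb _ (by
        rw [pair_mul_pair, hc, inv_mul_cancel_right])⟩
  have ha : a ∈ generated (Zm D ∪ Set.range d) := hgen ▸ Set.mem_univ a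
  refine ha _ hP (Set.union_subset (fun z hz => ⟨1, hZ hz⟩) ?_)
  rintro _ ⟨j, rfl⟩
  exact hP.rdiv_mem _ (hd j) _ hP.one_mem _ (T.isMetagroup.mul_ldiv _ _)

/-- Conjugation by an element `(a, x)` of `H` maps `b` to `x * ρ (π a) b * x⁻¹`; in class two, this
differs from `ρ (π a) b` by a central factor, which the fiber contains. -/
theorem fiber_invariant (hclass : ∀ a b : B, a * b * a⁻¹ * b⁻¹ ∈ Subgroup.center B)
    {H : Set T.Ext} (hH : IsSubloop H) (hcen : Subgroup.center B ≤ T.fiber hH)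
    (hfst : ∀ a, ∃ b, T.pair a b ∈ H) (q : Q) {b : B} (hb : b ∈ T.fiber hH) :
    T.ρ q b ∈ T.fiber hH := by
  obtain ⟨a, rfl⟩ := T.π_surjective q
  obtain ⟨x, hx⟩ := hfst a
  have h : x * T.ρ (T.π a) b * x⁻¹ ∈ T.fiber hH := by
    refine hH.rdiv_mem _ hx _ (hH.mul_mem _ hx _ hb) _ ?_
    simp [pair_mul_pair]
  have := mul_mem (hcen (inv_mem (hclass x (T.ρ (T.π a) b)))) h
  simpa [mul_assoc] using this

theorem eq_univ {H : Set T.Ext} (hH : IsSubloop H) (hfst : ∀ a, ∃ b, T.pair a b ∈ H)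
    (htop : T.fiber hH = ⊤) : H = Set.univ := by
  refine Set.eq_univ_of_forall fun x => ?_
  obtain ⟨a, b, rfl⟩ := T.exists_eq_pair x
  obtain ⟨b', h⟩ := hfst a
  have hb : b * b'⁻¹ ∈ T.fiber hH := htop ▸ Subgroup.mem_top _
  simpa [pair_mul_pair] using hH.mul_mem _ hb _ h

theorem mem_image_center {x : T.Ext} :
    x ∈ SmashingFactors.CStar.ofF T.closed '' Set.center ((RightTransversal.trivial D).FStar B) ↔
      ∃ b ∈ Subgroup.center B, x = T.pair 1 b := by
  constructor
  · rintro ⟨f, hf, rfl⟩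
    refine ⟨(fstarEquiv D B).symm f, (MulEquiv.mem_center (fstarEquiv D B).symm).2 hf, ?_⟩
    simp [pair, SmashingFactors.CStar.ofF]
  · rintro ⟨b, hb, rfl⟩
    exact ⟨fstarEquiv D B b, (MulEquiv.mem_center (fstarEquiv D B)).2 hb, rfl⟩

theorem mem_range_ofF {x : T.Ext} :
    x ∈ Set.range (SmashingFactors.CStar.ofF T.closed) ↔ ∃ b, x = T.pair 1 b := by
  constructor
  · rintro ⟨f, rfl⟩
    exact ⟨(fstarEquiv D B).symm f, by simp [pair, SmashingFactors.CStar.ofF]⟩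
  · rintro ⟨b, rfl⟩
    exact ⟨fstarEquiv D B b, rfl⟩

theorem isSubloop_range_ofF : IsSubloop (Set.range (SmashingFactors.CStar.ofF T.closed)) := by
  have hG := T.isMetagroup_ext
  refine ⟨T.mem_range_ofF.2 ⟨1, rfl⟩, ?_, ?_, ?_⟩
  · intro x hx y hy
    obtain ⟨a, rfl⟩ := T.mem_range_ofF.1 hx
    obtain ⟨b, rfl⟩ := T.mem_range_ofF.1 hy
    exact T.mem_range_ofF.2 ⟨a * b, by simp [pair_mul_pair]⟩
  · intro x hx y hy z hz
    obtain ⟨a, rfl⟩ := T.mem_range_ofF.1 hx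
    obtain ⟨b, rfl⟩ := T.mem_range_ofF.1 hy
    exact T.mem_range_ofF.2 ⟨a⁻¹ * b, hG.mul_left_cancel (hz.trans (by simp [pair_mul_pair]))⟩
  · intro x hx y hy z hz
    obtain ⟨a, rfl⟩ := T.mem_range_ofF.1 hx
    obtain ⟨b, rfl⟩ := T.mem_range_ofF.1 hy
    exact T.mem_range_ofF.2 ⟨b * a⁻¹, hG.mul_right_cancel (hz.trans (by simp [pair_mul_pair]))⟩

/-- The commutators give `b⁻¹ * ρ q b` for all `q` and `b`. Hence the fiber times the center is
`Q`-invariant, and the hypothesis on `m` applies to it. -/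
theorem commSubloop_mul_center (g : Q) (m : B)
    (hgm : ∀ K : Subgroup B, Subgroup.center B ≤ K → (∀ q, ∀ b ∈ K, T.ρ q b ∈ K) →
      m⁻¹ * T.ρ g m ∈ K → K = ⊤) :
    commSubloop (Set.range (SmashingFactors.CStar.ofF T.closed)) Set.univ *
        (SmashingFactors.CStar.ofF T.closed '' Set.center ((RightTransversal.trivial D).FStar B)) =
      Set.range (SmashingFactors.CStar.ofF T.closed) := by
  set F := Set.range (SmashingFactors.CStar.ofF T.closed)
  have hFs : IsSubloop F := T.isSubloop_range_ofF
  have hsub : commSubloop F Set.univ ⊆ F := by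
    refine generated_subset hFs ?_
    rintro _ ⟨f, hf, k, -, rfl⟩
    obtain ⟨b, rfl⟩ := T.mem_range_ofF.1 hf
    obtain ⟨d, c, rfl⟩ := T.exists_eq_pair k
    have h1 : rdiv (1 : D) 1 = 1 := T.isMetagroup.rdiv_eq (mul_one 1)
    have h2 : loopComm (1 : D) d = 1 := by
      rw [loopComm, h1, one_mul, one_mul, T.isMetagroup.rdiv_mul]
    simp only [loopComm, rdiv_one_pair, pair_mul_pair] at h2 ⊢
    rw [h2]
    exact T.mem_range_ofF.2 ⟨_, rfl⟩
  have hC : IsSubloop (commSubloop F Set.univ) := isSubloop_generated _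
  have hmem : ∀ q b, b⁻¹ * T.ρ q b ∈ T.fiber hC := by
    intro q b
    -- The inverse offsets the one in `loopComm_pair_one`.
    obtain ⟨d, hd⟩ := T.π_surjective q⁻¹
    have : loopComm (T.pair 1 b) (T.pair d 1) ∈ commSubloop F Set.univ :=
      subset_generated _ ⟨_, T.mem_range_ofF.2 ⟨b, rfl⟩, _, Set.mem_univ _, rfl⟩
    rw [loopComm_pair_one, hd] at this
    simpa [mem_fiber] using this
  have htop : T.fiber hC ⊔ Subgroup.center B = ⊤ := by
    refine hgm _ le_sup_right (fun q b hb => ?_) (Subgroup.mem_sup_left (hmem g m))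
    have := mul_mem hb (Subgroup.mem_sup_left (T := Subgroup.center B) (hmem q b))
    simpa using this
  apply Set.Subset.antisymm
  · rintro _ ⟨x, hx, y, hy, rfl⟩
    refine hFs.mul_mem _ (hsub hx) _ ?_
    obtain ⟨f, -, rfl⟩ := hy
    exact ⟨f, rfl⟩
  · intro x hx
    obtain ⟨b, rfl⟩ := T.mem_range_ofF.1 hx
    have hb : b ∈ T.fiber hC ⊔ Subgroup.center B := htop ▸ Subgroup.mem_top b
    obtain ⟨k, hk, z, hz, rfl⟩ := Subgroup.mem_sup_of_normal_right.1 hb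
    exact ⟨T.pair 1 k, hk, T.pair 1 z, T.mem_image_center.2 ⟨z, hz, rfl⟩, by
      simp [pair_mul_pair]⟩

theorem exists_generators
    (hclass : ∀ a b : B, a * b * a⁻¹ * b⁻¹ ∈ Subgroup.center B) {J : Type*} (d : J → D)
    (hgen : generated (Zm D ∪ Set.range d) = Set.univ) (m : B) {j₁ j₂ : J} (hj : j₁ ≠ j₂)
    (hcomm : loopComm (ldiv (d j₂) 1) (ldiv (d j₁) 1) = 1)
    (hgm : ∀ K : Subgroup B, Subgroup.center B ≤ K → (∀ q, ∀ b ∈ K, T.ρ q b ∈ K) →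
      m⁻¹ * T.ρ (T.π (d j₁)) m ∈ K → K = ⊤) :
    ∃ c : J → T.Ext,
      generated (SmashingFactors.CStar.ofF T.closed ''
          Set.center ((RightTransversal.trivial D).FStar B) ∪ Set.range c) = Set.univ ∧
        ∀ j, ∃ f : (RightTransversal.trivial D).FStar B,
          SmashingFactors.CStar.ofD T.closed (ldiv (d j) 1) =
            SmashingFactors.CStar.ofF T.closed f * c j := by
  classical
  -- Only the generator at `j₂` is twisted; its commutator with the one at `j₁` is then a translate
  -- of `m⁻¹ * g m`.
  let b : J → B := fun j => if j = j₂ then m else 1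
  let c : J → T.Ext := fun j => T.pair (ldiv (d j) 1) (b j)
  refine ⟨c, ?_, fun j => ⟨fstarEquiv D B (b j)⁻¹, ?_⟩⟩
  · set X := SmashingFactors.CStar.ofF T.closed ''
          Set.center ((RightTransversal.trivial D).FStar B) ∪ Set.range c
    have hH : IsSubloop (generated X) := isSubloop_generated _
    have hc : ∀ j, T.pair (ldiv (d j) 1) (b j) ∈ generated X := fun j =>
      subset_generated _ (Or.inr ⟨j, rfl⟩)
    have hfst := T.exists_pair_mem hH hgen fun j => ⟨_, hc j⟩
    have hcen : Subgroup.center B ≤ T.fiber hH := fun z hz =>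
      subset_generated _ (Or.inl (T.mem_image_center.2 ⟨z, hz, rfl⟩))
    have hinv := fun q b hb => T.fiber_invariant hclass hH hcen hfst q (b := b) hb
    refine T.eq_univ hH hfst (hgm _ hcen hinv ?_)
    have h1 := hc j₁
    have h2 := hc j₂
    simp only [b, if_neg hj, if_true] at h1 h2
    have h := hH.loopComm T.isMetagroup_ext.toIsLoop h2 h1
    rw [T.loopComm_pair _ _ _ hcomm] at h
    -- Invariance of the fiber removes the outer translation by the inverse of `π (d j₂ \ e)`.
    simpa [T.π_ldiv] using hinv (T.π (ldiv (d j₂) 1)) _ h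
  · change T.pair (ldiv (d j) 1) 1 = T.pair 1 (b j)⁻¹ * T.pair (ldiv (d j) 1) (b j)
    simp [pair_mul_pair]

end CentralAction

/-! ### The center of `D` and the final assembly. -/

theorem IsMetagroup.exists_center_group {D : Type u} [MulOneClass D] (hD : IsMetagroup D) :
    ∃ (Z : Type u) (_ : CommGroup Z) (j : Z →* D), Function.Injective j ∧
      Set.range j = Set.center D := by
  let : CommMonoid (Submonoid.center D) := Submonoid.center.commMonoid'
  refine ⟨(Submonoid.center D)ˣ, inferInstance,
    (Submonoid.center D).subtype.comp (Units.coeHom (Submonoid.center D)), ?_, ?_⟩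
  · exact Subtype.val_injective.comp Units.val_injective
  · apply Set.Subset.antisymm
    · rintro _ ⟨x, rfl⟩
      exact x.1.2
    · intro z hz
      have h := hD.mul_ldiv z 1
      have hz' := hD.center_of_mul_eq_one hz h
      exact ⟨⟨⟨z, hz⟩, ⟨_, hz'⟩, Subtype.ext h, Subtype.ext ((hz'.comm z).trans h)⟩, rfl⟩

/-- Otherwise `Q = {e, g}` and every element of `D` is `z` or `z * x` with `z` central and `x` a
fixed lift of `g`. Such a `D` is commutative and associative. -/
theorem exists_ne_of_center_ne {D Q : Type*} [MulOneClass D] [Group Q]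
    (π : D →* Q) (hπs : Function.Surjective π)
    (hπ : ∀ a b, π a = π b ↔ ∃ z ∈ Set.center D, a = z * b)
    (hc : Set.center D ≠ Set.univ) {g : Q} (hg : g ≠ 1) : ∃ h, h ≠ 1 ∧ h ≠ g := by
  by_contra! hcon
  refine hc (Set.eq_univ_of_forall fun a => ?_)
  obtain ⟨x, hx⟩ := hπs g
  have hπ1 : ∀ a, π a = 1 → a ∈ Set.center D := fun a ha => by
    obtain ⟨z, hz, rfl⟩ := (hπ a 1).1 (by rw [ha, map_one])
    rwa [mul_one]
  have hxx : x * x ∈ Set.center D := hπ1 _ (by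
    by_contra hne
    have := hcon _ hne
    rw [map_mul, hx] at this
    exact hg (mul_eq_left.1 this))
  have hrep : ∀ a, ∃ z ∈ Set.center D, a = z ∨ a = z * x := by
    intro a
    by_cases ha : π a = 1
    · exact ⟨a, hπ1 a ha, Or.inl rfl⟩
    · obtain ⟨z, hz, h⟩ := (hπ a x).1 (by rw [hcon _ ha, hx])
      exact ⟨z, hz, Or.inr h⟩
  have hcomm : ∀ a b : D, a * b = b * a := by
    intro a b
    obtain ⟨z, hz, rfl | rfl⟩ := hrep a
    · exact hz.comm b
    · obtain ⟨w, hw, rfl | rfl⟩ := hrep b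
      · exact (hw.comm _).symm
      · rw [center_mul_mul_center_mul hz hw, center_mul_mul_center_mul hw hz, (hz.comm w).eq]
  have hassoc : ∀ a b c : D, a * (b * c) = (a * b) * c := by
    intro a b c
    obtain ⟨z, hz, rfl | rfl⟩ := hrep a
    · exact hz.left_assoc b c
    obtain ⟨w, hw, rfl | rfl⟩ := hrep b
    · exact (hw.mid_assoc _ _).symm
    obtain ⟨y, hy, rfl | rfl⟩ := hrep c
    · exact (hy.right_assoc _ _).symm
    -- Once the central factors are pulled out, only `x * (x * x) = (x * x) * x` remains, and `x *
    -- x` is central.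
    rw [center_mul_mul_center_mul hw hy, center_mul_mul_center_mul hz (Set.mul_mem_center hw hy),
      center_mul_mul_center_mul hz hw, center_mul_mul_center_mul (Set.mul_mem_center hz hw) hy,
      hz.left_assoc, (hxx.comm x).eq]
  exact ⟨fun b => hcomm a b, fun b c => hassoc a b c, fun b c => (hassoc b c a).symm⟩

/-- The extension attached to an action of `D/Z(D)` on a group `B` of class at most two. -/
theorem exists_extension_of_action {D : Type u} [MulOneClass D] (hD : IsMetagroup D)
    {J : Type v} (d : J → D) (j₁ j₂ : J) (hj : j₁ ≠ j₂)
    (hgen : generated (Zm D ∪ Set.range d) = Set.univ)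
    (hcomm : loopComm (ldiv (d j₂) 1) (ldiv (d j₁) 1) = 1)
    {Q : Type u} [Group Q] (π : D →* Q) (hπs : Function.Surjective π)
    (hπ : ∀ a b, π a = π b ↔ ∃ z ∈ Set.center D, a = z * b)
    {B : Type u} [Group B] [Nontrivial B] (ρ : Q →* MulAut B) (m : B)
    (hclass : ∀ a b : B, a * b * a⁻¹ * b⁻¹ ∈ Subgroup.center B)
    (hB : Set.center D ≠ Set.univ → ∃ a b : B, a * b ≠ b * a)
    (hm : ∀ K : Subgroup B, Subgroup.center B ≤ K → (∀ q, ∀ b ∈ K, ρ q b ∈ K) →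
      m⁻¹ * ρ (π (d j₁)) m ∈ K → K = ⊤) :
    ∃ (A : Submonoid D) (V : RightTransversal A)
      (B : Type u) (_ : MulOneClass B) (Z : Type u) (_ : CommGroup Z)
      (S : SmashingFactors A B Z) (h : S.Closed V),
      IsSubloop (A : Set D) ∧ IsMetagroup B ∧
      IsMetagroup (S.CStar V h) ∧
      IsCentralMetagroup (V.FStar B) ∧
      Nontrivial (V.FStar B) ∧
      (Set.center D ≠ Set.univ → Set.center (V.FStar B) ≠ Set.univ) ∧
      commSubloop (Set.range (SmashingFactors.CStar.ofF h)) Set.univ *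
          (SmashingFactors.CStar.ofF h '' Set.center (V.FStar B)) =
        Set.range (SmashingFactors.CStar.ofF h) ∧
      ∃ c : J → S.CStar V h,
        generated (SmashingFactors.CStar.ofF h '' Set.center (V.FStar B) ∪ Set.range c) =
          Set.univ ∧
        ∀ j, ∃ f : V.FStar B,
          SmashingFactors.CStar.ofD h (ldiv (d j) 1) = SmashingFactors.CStar.ofF h f * c j := by
  obtain ⟨Z, _, jZ, hjZ, hrange⟩ := hD.exists_center_group
  -- The factor `Z` gives the required embedding into the center of the fiber group. It is central
  -- and fixed by `Q`, so the condition on `m` passes from `B` to `(1, m)`.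
  let T : CentralAction D Q (Z × B) Z :=
    { isMetagroup := hD
      π := π
      π_surjective := hπs
      π_eq := hπ
      ρ :=
        { toFun := fun q => MulEquiv.prodCongr (MulEquiv.refl Z) (ρ q)
          map_one' := MulEquiv.ext fun x =>
            Prod.ext rfl (congrArg (fun e : MulAut B => e x.2) (map_one ρ))
          map_mul' := fun q q' => MulEquiv.ext fun x =>
            Prod.ext rfl (congrArg (fun e : MulAut B => e x.2) (map_mul ρ q q')) }
      jZ := jZ
      jZ_injective := hjZ
      range_jZ := hrange
      jB := MonoidHom.inl Z B
      jB_injective := fun _ _ h => congrArg Prod.fst h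
      jB_center := fun γ => Semigroup.mem_center_iff.2 fun x => Prod.ext (mul_comm _ _) (by simp)
      ρ_jB := fun q γ => Prod.ext rfl (map_one (ρ q)) }
  have hρ : ∀ q z b, T.ρ q (z, b) = (z, ρ q b) := fun _ _ _ => rfl
  have hcen : ∀ z : Z, ∀ b ∈ Subgroup.center B, (z, b) ∈ Subgroup.center (Z × B) :=
    fun z b hb => Subgroup.mem_center_iff.2 fun x =>
      Prod.ext (mul_comm _ _) (Subgroup.mem_center_iff.1 hb x.2)
  have hclass' : ∀ a b : Z × B, a * b * a⁻¹ * b⁻¹ ∈ Subgroup.center (Z × B) :=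
    fun a b => hcen _ _ (hclass a.2 b.2)
  have hm' : ∀ K : Subgroup (Z × B), Subgroup.center (Z × B) ≤ K →
      (∀ q, ∀ b ∈ K, T.ρ q b ∈ K) →
      ((1, m) : Z × B)⁻¹ * T.ρ (π (d j₁)) (1, m) ∈ K → K = ⊤ := by
    intro K hK hinv hmK
    have h : K.comap (MonoidHom.inr Z B) = ⊤ := by
      refine hm _ (fun b hb => hK (hcen 1 b hb)) (fun q b hb => hinv q (1, b) hb) ?_
      simpa [Subgroup.mem_comap, hρ] using hmK
    rw [eq_top_iff]
    rintro ⟨z, b⟩ -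
    have h1 : ((1, b) : Z × B) ∈ K := (h ▸ Subgroup.mem_top b : b ∈ K.comap (MonoidHom.inr Z B))
    simpa using mul_mem (hK (hcen z 1 (one_mem _))) h1
  have hF : IsCentralMetagroup ((RightTransversal.trivial D).FStar (Z × B)) := by
    refine IsCentralMetagroup.of_mulEquiv ⟨IsMetagroup.of_group _, fun a b => ?_⟩
      (CentralAction.fstarEquiv D (Z × B))
    exact ⟨_, hclass' a b, by group⟩
  refine ⟨⊤, RightTransversal.trivial D, Z × B, inferInstance, Z, inferInstance,
    T.smashingFactors, T.closed, ⟨Set.mem_univ _, fun _ _ _ _ => Set.mem_univ _,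
      fun _ _ _ _ _ _ => Set.mem_univ _, fun _ _ _ _ _ _ => Set.mem_univ _⟩,
    IsMetagroup.of_group _, T.isMetagroup_ext, hF,
    (CentralAction.fstarEquiv D (Z × B)).injective.nontrivial, ?_,
    T.commSubloop_mul_center _ _ hm', T.exists_generators hclass' d hgen _ hj hcomm hm'⟩
  intro hne huniv
  obtain ⟨a, b, hab⟩ := hB hne
  have h := (MulEquiv.mem_center (CentralAction.fstarEquiv D (Z × B)) (x := (1, a))).1
    (huniv ▸ Set.mem_univ _)
  exact hab (congrArg Prod.snd (h.comm (1, b)).eq)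

theorem corollary4p15 {D : Type u} [MulOneClass D] (hD : IsMetagroup D)
    {J : Type v} (d : J → D) (j₁ j₂ : J) (hj : j₁ ≠ j₂)
    (hgen : generated (Zm D ∪ Set.range d) = Set.univ)
    (hd₁ : d j₁ ≠ 1)
    (hcomm : loopComm (ldiv (d j₂) 1) (ldiv (d j₁) 1) = 1) :
    ∃ (A : Submonoid D) (V : RightTransversal A)
      (B : Type u) (_ : MulOneClass B) (Z : Type u) (_ : CommGroup Z)
      (S : SmashingFactors A B Z) (h : S.Closed V),
      IsSubloop (A : Set D) ∧ IsMetagroup B ∧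
      -- `C*` is a metagroup, and `F*` is a non-trivial central metagroup
      IsMetagroup (S.CStar V h) ∧
      IsCentralMetagroup (V.FStar B) ∧
      Nontrivial (V.FStar B) ∧
      (Set.center D ≠ Set.univ → Set.center (V.FStar B) ≠ Set.univ) ∧
      -- `[F*, C*] Z(F*) = F*` inside `C*`
      commSubloop (Set.range (SmashingFactors.CStar.ofF h)) Set.univ *
          (SmashingFactors.CStar.ofF h '' Set.center (V.FStar B)) =
        Set.range (SmashingFactors.CStar.ofF h) ∧
      -- `C*` is generated by `Z(F*)` and elements `c_j` with `d_j \ e ∈ F* c_j`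
      ∃ c : J → S.CStar V h,
        generated (SmashingFactors.CStar.ofF h '' Set.center (V.FStar B) ∪ Set.range c) =
          Set.univ ∧
        ∀ j, ∃ f : V.FStar B,
          SmashingFactors.CStar.ofD h (ldiv (d j) 1) = SmashingFactors.CStar.ofF h f * c j := by
  obtain ⟨Q, _, π, hπs, hπ⟩ := hD.exists_central_quotient
  by_cases hc : Set.center D = Set.univ
  -- For abelian `B`, a subgroup containing the center is everything, so any nontrivial abelian
  -- group with trivial action will do.
  · refine exists_extension_of_action hD d j₁ j₂ hj hgen hcomm π hπs hπ
      (B := ULift.{u} (Multiplicative (ZMod 2))) 1 1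
      (fun a b => Subgroup.mem_center_iff.2 fun x => mul_comm _ _) (fun h => absurd hc h)
      fun K hK _ _ => eq_top_iff.2 fun x _ =>
        hK (Subgroup.mem_center_iff.2 fun y => mul_comm _ _)
  -- It suffices to treat the case in which `d j₁` is not central.
  suffices key : ∀ i₁ i₂ : J, i₁ ≠ i₂ → loopComm (ldiv (d i₂) 1) (ldiv (d i₁) 1) = 1 →
      π (d i₁) ≠ 1 → _ by
    by_cases h1 : π (d j₁) = 1
    -- If all `d j` were central, `D` would be generated by central elements.
    · obtain ⟨j, hjne⟩ : ∃ j, π (d j) ≠ 1 := by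
        by_contra! hall
        refine hc (Set.eq_univ_of_forall fun a => ?_)
        have ha : a ∈ generated (Zm D ∪ Set.range d) := hgen ▸ Set.mem_univ a
        refine ha _ hD.isSubloop_center (Set.union_subset hD.Zm_subset_center ?_)
        rintro _ ⟨j, rfl⟩
        obtain ⟨z, hz, h⟩ := (hπ (d j) 1).1 (by rw [hall, map_one])
        rwa [h, mul_one]
      -- The central `d j₁` now takes the second place, where its commutator with anything is
      -- trivial.
      refine key j j₁ (fun h => hjne (h ▸ h1)) ?_ hjne
      have hz : ldiv (d j₁) 1 ∈ Set.center D := by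
        obtain ⟨z, hz, h⟩ := (hπ (d j₁) 1).1 (by rw [h1, map_one])
        refine hD.center_of_mul_eq_one ?_ (hD.mul_ldiv (d j₁) 1)
        rwa [h, mul_one]
      rw [loopComm, ← hz.left_comm, hD.rdiv_mul, mul_one, hD.rdiv_mul]
    · exact key j₁ j₂ hj hcomm h1
  intro i₁ i₂ hi hcomm' hne
  obtain ⟨h₀, hh1, hhg⟩ := exists_ne_of_center_ne π hπs hπ hc hne
  obtain ⟨B, _, ρ, m, hclass, ⟨a, b, hab⟩, hm⟩ := exists_action_of_ne_one hne hh1 hhg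
  have : Nontrivial B := ⟨⟨a * b, b * a, hab⟩⟩
  exact exists_extension_of_action hD d i₁ i₂ hi hgen hcomm' π hπs hπ ρ m hclass
    (fun _ => ⟨a, b, hab⟩) hm
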